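/- A measure-theoretical dynamical system (MDS) $(X,\mathcal B,\mu,T)$ is a probability space with a measurable map $T:X\to X$ preserving $\mu$. It is invertible if $T$ has a measurable two-sided inverse modulo $\mu$-null sets. For an increasing sequence $S=\{s_1<s_2<\cdots\}$ of positive integers let $\overline D(S)=\inf\{\tau\ge 0:\limsup_{n\to\infty} n/s_n^{\tau}=0\}$ and $\underline D(S)=\inf\{\tau\ge 0:\liminf_{n\to\infty} n/s_n^{\tau}=0\}$. For a finite measurable partition $\xi$ of $X$, $S$ is an entropy generating sequence of $\xi$ if $\liminf_{n\to\infty}\frac1n H_\mu\big(\bigvee_{i=1}^n T^{-s_i}\xi\big)>0$, where $H_\mu$ is Shannon entropy. Let $\overline D_\mu(T,\xi)$ (resp. $\underline D_\mu(T,\xi)$) be the supremum of $\overline D(S)$ (resp. $\underline D(S)$) over all entropy generating sequences $S$ of $\xi$, and $0$ if there are none. Let $\overline D_\mu(X,T)$ and $\underline D_\mu(X,T)$ be the suprema of these quantities over all finite measurable partitions $\xi$ of $X$; if they coincide, their common value is the entropy dimension of the system. The dimension set is $$Dims_\mu(X,T)=\{\overline D_\mu(T,\{A,X\setminus A\}):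 A\in\mathcal B,\ 0<\mu(A)<1\}.$$ For $\tau\in[0,1]$ the system is a $\tau$-u.d. system if $Dims_\mu(X,T)=\{\tau\}$; it has strictly positive entropy dimension if $0\notin Dims_\mu(X,T)$. A joining of $(X,\mathcal B,\mu,T)$ and $(Y,\mathcal D,\nu,S)$ is a $T\times S$-invariant probability measure on $(X\times Y,\mathcal B\otimes\mathcal D)$ with marginals $\mu$ and $\nu$. The systems are disjoint if $\mu\times\nu$ is their only joining. **Corollary.** 1. If $1\ge\alpha>\beta\ge 0$, then every invertible $\alpha$-u.d. MDS is disjoint from every ergodic $\beta$-u.d. MDS. 2. Every invertible MDS with strictly positive entropy dimension is disjoint from every ergodic MDS of entropy dimension $0$. -/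

import Mathlib

open MeasureTheory
open scoped ENNReal NNReal

namespace EntropyDimension

/-- The increasing sequences `s 0 < s 1 < ⋯` of positive integers (`s n` is the `(n+1)`-st term). -/
def IsPosSeq (s : ℕ → ℕ) : Prop := StrictMono s ∧ 0 < s 0

/-- `limsup_n n / (s_n)^τ`, the sequence being enumerated from `1` in this formula. -/
noncomputable def upperDensity (s : ℕ → ℕ) (τ : ℝ≥0) : ℝ≥0∞ :=
  Filter.limsup (fun n : ℕ => ((n + 1 : ℕ) : ℝ≥0∞) / ((s n : ℕ) : ℝ≥0∞) ^ (τ : ℝ)) Filter.atTop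

/-- `liminf_n n / (s_n)^τ`, the sequence being enumerated from `1` in this formula. -/
noncomputable def lowerDensity (s : ℕ → ℕ) (τ : ℝ≥0) : ℝ≥0∞ :=
  Filter.liminf (fun n : ℕ => ((n + 1 : ℕ) : ℝ≥0∞) / ((s n : ℕ) : ℝ≥0∞) ^ (τ : ℝ)) Filter.atTop

/-- The upper dimension of a sequence: `inf {τ ≥ 0 : upperDensity s τ = 0}`. -/
noncomputable def upperSeqDim (s : ℕ → ℕ) : ℝ≥0∞ :=
  ⨅ (τ : ℝ≥0) (_ : upperDensity s τ = 0), (τ : ℝ≥0∞)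

/-- The lower dimension of a sequence: `inf {τ ≥ 0 : lowerDensity s τ = 0}`. -/
noncomputable def lowerSeqDim (s : ℕ → ℕ) : ℝ≥0∞ :=
  ⨅ (τ : ℝ≥0) (_ : lowerDensity s τ = 0), (τ : ℝ≥0∞)

/-- A partition of `X` into `k` measurable sets (empty atoms are harmless). -/
structure MeasPartition (X : Type*) [MeasurableSpace X] (k : ℕ) where
  atom : Fin k → Set X
  measurableSet_atom : ∀ i, MeasurableSet (atom i)
  disjoint_atom : ∀ i j, i ≠ j → Disjoint (atom i) (atom j)
  iUnion_atom : ⋃ i, atom i = Set.univ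

/-- The partition `{A, X \ A}`. -/
def MeasPartition.ofSet {X : Type*} [MeasurableSpace X] (A : Set X) (hA : MeasurableSet A) :
    MeasPartition X 2 where
  atom := ![A, Aᶜ]
  measurableSet_atom := by
    intro i
    fin_cases i
    · exact hA
    · exact hA.compl
  disjoint_atom := by
    intro i j hij
    fin_cases i <;> fin_cases j
    · exact absurd rfl hij
    · exact disjoint_compl_right
    · exact disjoint_compl_left
    · exact absurd rfl hij
  iUnion_atom := by
    ext x
    simp only [Set.mem_iUnion, Set.mem_univ, iff_true]
    by_cases hx : x ∈ A
    · exact ⟨0, hx⟩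
    · exact ⟨1, hx⟩

/-- The Shannon entropy `-∑ μ(A) log μ(A)` of a finite family of sets. -/
noncomputable def shannonEntropy {X : Type*} [MeasurableSpace X] (μ : Measure X)
    {ι : Type*} [Fintype ι] (A : ι → Set X) : ℝ :=
  ∑ i, Real.negMulLog (μ.real (A i))

/-- The atoms of the join of `T^{-s 0} P, …, T^{-s (n-1)} P`, indexed by the names
`c : Fin n → Fin k`. -/
def joinAtom {X : Type*} [MeasurableSpace X] (T : X → X) {k : ℕ} (P : MeasPartition X k)
    (s : ℕ → ℕ) (n : ℕ) (c : Fin n → Fin k) : Set X :=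
  ⋂ i : Fin n, T^[s i] ⁻¹' P.atom (c i)

/-- `s` is an entropy generating sequence of the partition `P`. -/
def IsEntropyGenerating {X : Type*} [MeasurableSpace X] (μ : Measure X) (T : X → X)
    {k : ℕ} (P : MeasPartition X k) (s : ℕ → ℕ) : Prop :=
  IsPosSeq s ∧
    0 < Filter.liminf
      (fun n : ℕ => ((1 / (n : ℝ) * shannonEntropy μ (joinAtom T P s n) : ℝ) : EReal))
      Filter.atTop

/-- The upper entropy dimension of a partition (`0` if there is no entropy generating
sequence, as the supremum is taken in `[0, ∞]`). -/
noncomputable def upperPartDim {X : Type*} [MeasurableSpace X] (μ : Measure X) (T : X → X)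
    {k : ℕ} (P : MeasPartition X k) : ℝ≥0∞ :=
  ⨆ (s : ℕ → ℕ) (_ : IsEntropyGenerating μ T P s), upperSeqDim s

/-- The lower entropy dimension of a partition. -/
noncomputable def lowerPartDim {X : Type*} [MeasurableSpace X] (μ : Measure X) (T : X → X)
    {k : ℕ} (P : MeasPartition X k) : ℝ≥0∞ :=
  ⨆ (s : ℕ → ℕ) (_ : IsEntropyGenerating μ T P s), lowerSeqDim s

/-- The upper metric entropy dimension of a system. -/
noncomputable def upperEntropyDim {X : Type*} [MeasurableSpace X] (μ : Measure X)
    (T : X → X) : ℝ≥0∞ :=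
  ⨆ (k : ℕ) (P : MeasPartition X k), upperPartDim μ T P

/-- The lower metric entropy dimension of a system. -/
noncomputable def lowerEntropyDim {X : Type*} [MeasurableSpace X] (μ : Measure X)
    (T : X → X) : ℝ≥0∞ :=
  ⨆ (k : ℕ) (P : MeasPartition X k), lowerPartDim μ T P

/-- The metric entropy dimension of the system exists and equals `d`. -/
def HasEntropyDim {X : Type*} [MeasurableSpace X] (μ : Measure X) (T : X → X)
    (d : ℝ≥0∞) : Prop :=
  upperEntropyDim μ T = d ∧ lowerEntropyDim μ T = d

/-- The dimension set of a system. -/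
def dims {X : Type*} [MeasurableSpace X] (μ : Measure X) (T : X → X) : Set ℝ≥0∞ :=
  {d | ∃ (A : Set X) (hA : MeasurableSet A), 0 < μ A ∧ μ A < 1 ∧
    d = upperPartDim μ T (MeasPartition.ofSet A hA)}

/-- The system is a `τ`-uniform entropy dimension system. -/
def IsUniformDim {X : Type*} [MeasurableSpace X] (μ : Measure X) (T : X → X)
    (τ : ℝ≥0∞) : Prop :=
  dims μ T = {τ}

/-- The system has strictly positive entropy dimension. -/
def StrictlyPositiveDim {X : Type*} [MeasurableSpace X] (μ : Measure X) (T : X → X) : Prop :=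
  (0 : ℝ≥0∞) ∉ dims μ T

/-- `T` is invertible (modulo null sets): it has a measurable two-sided inverse almost
everywhere. -/
def IsInvertible {X : Type*} [MeasurableSpace X] (μ : Measure X) (T : X → X) : Prop :=
  ∃ T' : X → X, Measurable T' ∧ (∀ᵐ x ∂μ, T' (T x) = x) ∧ (∀ᵐ x ∂μ, T (T' x) = x)

/-- `ρ` is a joining of the systems `(X, μ, T)` and `(Y, ν, S)`. -/
structure IsJoining {X Y : Type*} [MeasurableSpace X] [MeasurableSpace Y]
    (μ : Measure X) (T : X → X) (ν : Measure Y) (S : Y → Y) (ρ : Measure (X × Y)) : Prop where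
  isProbabilityMeasure : IsProbabilityMeasure ρ
  invariant : ρ.map (Prod.map T S) = ρ
  map_fst : ρ.map Prod.fst = μ
  map_snd : ρ.map Prod.snd = ν

/-- The systems are disjoint: the product measure is their only joining. -/
def AreDisjoint {X Y : Type*} [MeasurableSpace X] [MeasurableSpace Y]
    (μ : Measure X) (T : X → X) (ν : Measure Y) (S : Y → Y) : Prop :=
  {ρ : Measure (X × Y) | IsJoining μ T ν S ρ} = {μ.prod ν}

end EntropyDimension

/-! Let `ρ` be a joining other than the product. Some `B` then has a non-constant conditional
probability `g x = ρ(B | x)`. Its mean is `t = ν(B)`, so `A = {g > t}` has measure strictly between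
`0` and `1`. The key claim (`IsEntropyGenerating.of_level`) is that every entropy generating
sequence of `{A, Aᶜ}` also generates entropy for `{B, Bᶜ}`. The upper dimension of the first
partition is then at most that of the second (`exists_upperPartDim_le`), which both hypotheses of
the corollary forbid.

For the claim, fix `x` and draw `m` conditionally independent `B`-names along `s`. Since `T` is
invertible, the chance of being in `B` at time `s i` is `g (T^[s i] x)`
(`condProb_preimage_iterate`). A vote with threshold `t + η` therefore recovers the `A`-name of `x`,
except on the strip `t < g < t + 2η` and for a Chebyshev error `1 / (m η²)`. Hence the entropy of
`N` letters of the `A`-name is at most `m` times that of the `B`-name plus a small multiple of `N`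
(`shannonEntropy_level_le`).

No space of copies is built. Gibbs' inequality is applied with reference law `voteLaw`, the noisy
vote of `m` independent names of unconditional law `P`, and its logarithm is bounded by averaging
over the conditional law at `x`. -/

namespace EntropyDimension

/-! ### Gibbs' inequality and moments of independent samples -/

/-- Gibbs' inequality for finite families. -/
theorem sum_negMulLog_le {α : Type*} [Fintype α] (p q : α → ℝ) (hp : ∀ a, 0 ≤ p a)
    (hq : ∀ a, 0 < q a) (hsp : ∑ a, p a = 1) (hsq : ∑ a, q a = 1) :
    ∑ a, Real.negMulLog (p a) ≤ ∑ a, p a * -Real.log (q a) := by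
  have h : ∀ a, Real.negMulLog (p a) ≤ p a * -Real.log (q a) + (q a - p a) := by
    intro a
    rcases (hp a).eq_or_lt with h0 | h0
    · simp [← h0, (hq a).le]
    · have h1 := Real.log_le_sub_one_of_pos (div_pos (hq a) h0)
      rw [Real.log_div (hq a).ne' h0.ne'] at h1
      have h2 := mul_le_mul_of_nonneg_left h1 h0.le
      have h3 : p a * (q a / p a - 1) = q a - p a := by field_simp
      rw [Real.negMulLog]
      linarith
  calc ∑ a, Real.negMulLog (p a) ≤ ∑ a, (p a * -Real.log (q a) + (q a - p a)) :=
        Finset.sum_le_sum fun a _ => h a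
    _ = _ := by rw [Finset.sum_add_distrib, Finset.sum_sub_distrib, hsp, hsq]; simp

section Product

variable {C : Type*} [Fintype C]

theorem sum_prod_eq_one (w : C → ℝ) (hw : ∑ c, w c = 1) (m : ℕ) :
    ∑ f : Fin m → C, ∏ j, w (f j) = 1 := by
  classical
  rw [← Fintype.sum_pow, hw, one_pow]

theorem sum_fin_succ_fun {m : ℕ} (G : (Fin (m + 1) → C) → ℝ) :
    ∑ f, G f = ∑ c : C, ∑ f : Fin m → C, G (Fin.cons c f) := by
  rw [← Fintype.sum_prod_type']
  exact (Fintype.sum_equiv (Fin.consEquiv fun _ => C) _ _ fun _ => rfl).symm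

theorem sum_prod_mul_sum (w : C → ℝ) (hw : ∑ c, w c = 1) (v : C → ℝ) (m : ℕ) :
    ∑ f : Fin m → C, (∏ j, w (f j)) * ∑ j, v (f j) = m * ∑ c, w c * v c := by
  induction m with
  | zero => simp
  | succ m ih =>
    rw [sum_fin_succ_fun]
    have h : ∀ c (f : Fin m → C), (∏ j, w ((Fin.cons c f : Fin (m + 1) → C) j)) *
        ∑ j, v ((Fin.cons c f : Fin (m + 1) → C) j) =
        (w c * v c) * (∏ j, w (f j)) + w c * ((∏ j, w (f j)) * ∑ j, v (f j)) := by
      intro c f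
      rw [Fin.prod_univ_succ, Fin.sum_univ_succ]
      simp only [Fin.cons_zero, Fin.cons_succ]
      ring
    simp_rw [h, Finset.sum_add_distrib, ← Finset.mul_sum, ih, sum_prod_eq_one w hw,
      ← Finset.sum_mul, hw]
    push_cast
    ring

/-- Independent centred variables are uncorrelated, so the variances add up. -/
theorem sum_prod_mul_sum_sq (w : C → ℝ) (hw : ∑ c, w c = 1) (v : C → ℝ)
    (hv : ∑ c, w c * v c = 0) (m : ℕ) :
    ∑ f : Fin m → C, (∏ j, w (f j)) * (∑ j, v (f j)) ^ 2 = m * ∑ c, w c * v c ^ 2 := by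
  induction m with
  | zero => simp
  | succ m ih =>
    rw [sum_fin_succ_fun]
    have h : ∀ c (f : Fin m → C), (∏ j, w ((Fin.cons c f : Fin (m + 1) → C) j)) *
        (∑ j, v ((Fin.cons c f : Fin (m + 1) → C) j)) ^ 2 =
        (w c * v c ^ 2) * (∏ j, w (f j)) + (w c * v c) * (2 * ((∏ j, w (f j)) * ∑ j, v (f j))) +
          w c * ((∏ j, w (f j)) * (∑ j, v (f j)) ^ 2) := by
      intro c f
      rw [Fin.prod_univ_succ, Fin.sum_univ_succ]
      simp only [Fin.cons_zero, Fin.cons_succ]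
      ring
    simp_rw [h, Finset.sum_add_distrib, ← Finset.mul_sum, ih, sum_prod_eq_one w hw,
      ← Finset.sum_mul, hw, hv]
    push_cast
    ring

end Product

/-! ### Noisy majority votes -/

/-- The majority vote, with threshold `θ`, of `m` binary names at the coordinate `i`. -/
noncomputable def vote (θ : ℝ) {N m : ℕ} (f : Fin m → Fin N → Fin 2) (i : Fin N) : Fin 2 :=
  if θ * m < ∑ j, (if f j i = 0 then 1 else 0 : ℝ) then 0 else 1

/-- The distribution of a noisy vote of `m` independent names of distribution `P`. -/
noncomputable def voteLaw (θ ε : ℝ) {N : ℕ} (m : ℕ) (P : (Fin N → Fin 2) → ℝ)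
    (a : Fin N → Fin 2) : ℝ :=
  ∑ f : Fin m → Fin N → Fin 2, (∏ j, P (f j)) * ∏ i, (if a i = vote θ f i then 1 - ε else ε)

theorem sum_voteLaw (θ ε : ℝ) {N : ℕ} (m : ℕ) (P : (Fin N → Fin 2) → ℝ) (hP : ∑ c, P c = 1) :
    ∑ a, voteLaw θ ε m P a = 1 := by
  unfold voteLaw
  rw [Finset.sum_comm]
  refine (Finset.sum_congr rfl fun f _ => ?_).trans (sum_prod_eq_one P hP m)
  rw [← Finset.mul_sum]
  refine mul_right_eq_self₀.2 (Or.inl ?_)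
  have h := (Finset.prod_univ_sum (fun _ : Fin N => (Finset.univ : Finset (Fin 2)))
    (fun i b => (if b = vote θ f i then 1 - ε else ε))).symm
  rw [Fintype.piFinset_univ] at h
  rw [h]
  refine Finset.prod_eq_one fun i _ => ?_
  rw [Fin.sum_univ_two]
  have h2 : vote θ f i = 0 ∨ vote θ f i = 1 := by omega
  rcases h2 with h2 | h2 <;> simp [h2]

theorem noise_pos {ε : ℝ} (hε : 0 < ε) (hε1 : ε < 1) (p : Prop) [Decidable p] :
    0 < (if p then 1 - ε else ε) := by
  split_ifs <;> linarith

theorem term_le_voteLaw (θ : ℝ) {ε : ℝ} (hε : 0 < ε) (hε1 : ε < 1) {N m : ℕ}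
    {P : (Fin N → Fin 2) → ℝ} (hP : ∀ c, 0 ≤ P c) (a : Fin N → Fin 2)
    (f : Fin m → Fin N → Fin 2) :
    (∏ j, P (f j)) * ∏ i, (if a i = vote θ f i then 1 - ε else ε) ≤ voteLaw θ ε m P a := by
  refine Finset.single_le_sum (f := fun f : Fin m → Fin N → Fin 2 =>
    (∏ j, P (f j)) * ∏ i, (if a i = vote θ f i then 1 - ε else ε)) (fun f _ => ?_)
    (Finset.mem_univ f)
  exact mul_nonneg (Finset.prod_nonneg fun j _ => hP _)
    (Finset.prod_nonneg fun i _ => (noise_pos hε hε1 _).le)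

theorem voteLaw_pos (θ : ℝ) {ε : ℝ} (hε : 0 < ε) (hε1 : ε < 1) {N : ℕ} (m : ℕ)
    {P : (Fin N → Fin 2) → ℝ} (hP : ∀ c, 0 ≤ P c) (hP1 : ∑ c, P c = 1) (a : Fin N → Fin 2) :
    0 < voteLaw θ ε m P a := by
  obtain ⟨c, -, hc⟩ : ∃ c ∈ Finset.univ, 0 < P c :=
    Finset.exists_lt_of_sum_lt (by simp [hP1])
  refine lt_of_lt_of_le ?_ (term_le_voteLaw θ hε hε1 hP a fun _ : Fin m => c)
  exact mul_pos (Finset.prod_pos fun _ _ => hc) (Finset.prod_pos fun i _ => noise_pos hε hε1 _)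

/-- The probability that the vote of `m` independent names of distribution `w` is not `b`. -/
noncomputable def voteError (θ : ℝ) {N : ℕ} (m : ℕ) (w : (Fin N → Fin 2) → ℝ) (b : Fin 2)
    (i : Fin N) : ℝ :=
  ∑ f : Fin m → Fin N → Fin 2, (∏ j, w (f j)) * (if b = vote θ f i then 0 else 1)

/-- Each tuple `f` alone bounds `voteLaw` from below. The resulting bounds on `-log` are averaged
over tuples drawn from another law `w`, later the conditional law at a point. This costs the cross
entropy of `w` and `P` once per copy, and `-log ε` per expected wrong vote. -/
theorem neg_log_voteLaw_le (θ : ℝ) {ε : ℝ} (hε : 0 < ε) (hε1 : ε < 1) {N : ℕ} (m : ℕ)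
    {P w : (Fin N → Fin 2) → ℝ} (hP : ∀ c, 0 ≤ P c) (hw : ∀ c, 0 ≤ w c) (hw1 : ∑ c, w c = 1)
    (hwP : ∀ c, P c = 0 → w c = 0) (a : Fin N → Fin 2) :
    -Real.log (voteLaw θ ε m P a) ≤ m * ∑ c, w c * -Real.log (P c) +
      ∑ i, (-Real.log (1 - ε) + -Real.log ε * voteError θ m w (a i) i) := by
  have key : ∀ f : Fin m → Fin N → Fin 2,
      (∏ j, w (f j)) * -Real.log (voteLaw θ ε m P a) ≤
      (∏ j, w (f j)) * (∑ j, -Real.log (P (f j)) +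
        ∑ i, (-Real.log (1 - ε) + -Real.log ε * (if a i = vote θ f i then 0 else 1))) := by
    intro f
    -- A tuple containing a `P`-null name has weight zero, so the convention `log 0 = 0` does no
    -- harm.
    by_cases h0 : ∃ j, P (f j) = 0
    · obtain ⟨j, hj⟩ := h0
      rw [Finset.prod_eq_zero (Finset.mem_univ j) (hwP _ hj)]
      simp
    push Not at h0
    refine mul_le_mul_of_nonneg_left ?_ (Finset.prod_nonneg fun j _ => hw _)
    have hr : ∀ i, 0 < (if a i = vote θ f i then 1 - ε else ε) := fun i => noise_pos hε hε1 _
    have hlog := Real.log_le_log (mul_pos (Finset.prod_pos fun j _ =>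
      lt_of_le_of_ne (hP (f j)) (h0 j).symm) (Finset.prod_pos fun i _ => hr i))
      (term_le_voteLaw θ hε hε1 hP a f)
    rw [Real.log_mul (Finset.prod_ne_zero_iff.2 fun j _ => h0 j)
      (Finset.prod_ne_zero_iff.2 fun i _ => (hr i).ne'), Real.log_prod fun j _ => h0 j,
      Real.log_prod fun i _ => (hr i).ne'] at hlog
    -- The cost `-log (1 - ε)` is charged at every coordinate, even at those where the vote is
    -- wrong.
    have h1 : -∑ i, Real.log (if a i = vote θ f i then 1 - ε else ε) ≤
        ∑ i, (-Real.log (1 - ε) + -Real.log ε * (if a i = vote θ f i then 0 else 1)) := by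
      rw [← Finset.sum_neg_distrib]
      refine Finset.sum_le_sum fun i _ => ?_
      split_ifs
      · simp
      · have := Real.log_nonpos (by linarith : 0 ≤ 1 - ε) (by linarith)
        linarith
    rw [Finset.sum_neg_distrib]
    linarith
  have hsum := Finset.sum_le_sum fun f (_ : f ∈ Finset.univ) => key f
  rw [← Finset.sum_mul, sum_prod_eq_one w hw1, one_mul] at hsum
  refine hsum.trans (le_of_eq ?_)
  simp_rw [fun f : Fin m → Fin N → Fin 2 => mul_add (∏ j, w (f j))]
  rw [Finset.sum_add_distrib]
  rw [sum_prod_mul_sum w hw1 fun c => -Real.log (P c)]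
  congr 1
  simp_rw [Finset.mul_sum]
  rw [Finset.sum_comm]
  refine Finset.sum_congr rfl fun i _ => ?_
  simp_rw [mul_add, Finset.sum_add_distrib]
  rw [← Finset.sum_mul, sum_prod_eq_one w hw1, one_mul, voteError, Finset.mul_sum]
  congr 1
  exact Finset.sum_congr rfl fun f _ => by ring

/-- Chebyshev's bound for the probability of a wrong vote. -/
theorem voteError_le {t η : ℝ} (hη : 0 < η) {N m : ℕ} (hm : 0 < m)
    {w : (Fin N → Fin 2) → ℝ} (hw : ∀ c, 0 ≤ w c) (hw1 : ∑ c, w c = 1) (b : Fin 2)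
    (i : Fin N) {g : ℝ} (hg : ∑ c, w c * (if c i = 0 then 1 else 0) = g) (hb : b = 0 ↔ t < g) :
    voteError (t + η) m w b i ≤ (if t < g ∧ g < t + 2 * η then 1 else 0) + 1 / (m * η ^ 2) := by
  have hm' : (0 : ℝ) < m := by exact_mod_cast hm
  have hprod : ∀ f : Fin m → Fin N → Fin 2, 0 ≤ ∏ j, w (f j) :=
    fun f => Finset.prod_nonneg fun j _ => hw _
  have hpos : 0 ≤ 1 / (m * η ^ 2) := by positivity
  -- Inside the strip the error is only bounded by `1`. Outside it, `g` lies at distance at least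
  -- `η` from the threshold `t + η`, on the side prescribed by `b`.
  by_cases hA : t < g ∧ g < t + 2 * η
  · rw [if_pos hA]
    have : voteError (t + η) m w b i ≤ 1 := by
      refine (Finset.sum_le_sum fun f _ => ?_).trans (sum_prod_eq_one w hw1 m).le
      have := hprod f
      split_ifs <;> simp [this]
    linarith
  rw [if_neg hA, zero_add]
  have hg0 : 0 ≤ g := by
    rw [← hg]
    exact Finset.sum_nonneg fun c _ => mul_nonneg (hw c) (by split_ifs <;> norm_num)
  have hg1 : g ≤ 1 := by
    rw [← hg]
    refine (Finset.sum_le_sum fun c _ => ?_).trans hw1.le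
    have := hw c
    split_ifs <;> simp [this]
  set v : (Fin N → Fin 2) → ℝ := fun c => (if c i = 0 then 1 else 0) - g with hv
  have hv0 : ∑ c, w c * v c = 0 := by
    simp_rw [hv, mul_sub, Finset.sum_sub_distrib]
    rw [hg, ← Finset.sum_mul, hw1]
    ring
  have hv1 : ∑ c, w c * v c ^ 2 ≤ 1 := by
    refine (Finset.sum_le_sum fun c _ => ?_).trans hw1.le
    refine mul_le_of_le_one_right (hw c) ?_
    simp only [hv]
    split_ifs <;> nlinarith
  have hsq := sum_prod_mul_sum_sq w hw1 v hv0 m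
  have hbound : voteError (t + η) m w b i ≤
      ∑ f : Fin m → Fin N → Fin 2, (∏ j, w (f j)) * ((∑ j, v (f j)) ^ 2 / (m * η) ^ 2) := by
    refine Finset.sum_le_sum fun f _ => mul_le_mul_of_nonneg_left ?_ (hprod f)
    split_ifs with hbv
    · positivity
    rw [le_div_iff₀ (by positivity), one_mul]
    have hsumv : ∑ j, v (f j) = ∑ j, (if f j i = 0 then 1 else 0 : ℝ) - m * g := by
      simp [hv, Finset.sum_sub_distrib]
    -- A wrong vote forces the centred sum to deviate by at least `m η`.
    rw [sq_le_sq, abs_of_pos (by positivity : 0 < m * η)]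
    rw [vote] at hbv
    split_ifs at hbv with hθ
    · have hgt : g ≤ t := not_lt.1 fun h => hbv (hb.2 h)
      refine le_trans ?_ (le_abs_self _)
      rw [hsumv]
      nlinarith
    · have hgt : t < g := hb.1 (by omega)
      have hgt' : t + 2 * η ≤ g := not_lt.1 fun h => hA ⟨hgt, h⟩
      refine le_trans ?_ (neg_le_abs _)
      rw [hsumv]
      nlinarith
  refine hbound.trans ?_
  simp_rw [← mul_div_assoc]
  rw [← Finset.sum_div, hsq]
  rw [div_le_div_iff₀ (by positivity) (by positivity)]
  have : (m : ℝ) * ∑ c, w c * v c ^ 2 ≤ m := mul_le_of_le_one_right hm'.le hv1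
  nlinarith [mul_le_mul_of_nonneg_right this (by positivity : 0 ≤ m * η ^ 2)]

/-! ### Conditional probabilities under a joining -/

section CondProb

variable {X Y : Type*} [MeasurableSpace X] [MeasurableSpace Y]

/-- The measure `A ↦ ρ (A ×ˢ D)`. -/
noncomputable def fiberMeasure (ρ : Measure (X × Y)) (D : Set Y) : Measure X :=
  (ρ.restrict (Prod.snd ⁻¹' D)).map Prod.fst

/-- The conditional probability under `ρ` of `D` given the first coordinate. -/
noncomputable def condProb (μ : Measure X) (ρ : Measure (X × Y)) (D : Set Y) (x : X) : ℝ :=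
  ((fiberMeasure ρ D).rnDeriv μ x).toReal

theorem fiberMeasure_apply (ρ : Measure (X × Y)) (D : Set Y) {A : Set X}
    (hA : MeasurableSet A) : fiberMeasure ρ D A = ρ (A ×ˢ D) := by
  rw [fiberMeasure, Measure.map_apply measurable_fst hA,
    Measure.restrict_apply (measurable_fst hA), Set.prod_eq]

instance (ρ : Measure (X × Y)) [IsFiniteMeasure ρ] (D : Set Y) :
    IsFiniteMeasure (fiberMeasure ρ D) := by
  unfold fiberMeasure
  infer_instance

theorem measurable_condProb (μ : Measure X) (ρ : Measure (X × Y)) (D : Set Y) :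
    Measurable (condProb μ ρ D) :=
  (Measure.measurable_rnDeriv _ _).ennreal_toReal

theorem condProb_nonneg (μ : Measure X) (ρ : Measure (X × Y)) (D : Set Y) (x : X) :
    0 ≤ condProb μ ρ D x :=
  ENNReal.toReal_nonneg

section Joining

variable {μ : Measure X} {T : X → X} {ν : Measure Y} {S : Y → Y} {ρ : Measure (X × Y)}

theorem integrable_condProb [IsFiniteMeasure ρ] (D : Set Y) : Integrable (condProb μ ρ D) μ :=
  Measure.integrable_toReal_rnDeriv

theorem setIntegral_condProb [IsFiniteMeasure μ] [IsFiniteMeasure ρ] (hρ : ρ.map Prod.fst = μ)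
    (D : Set Y) {A : Set X} (hA : MeasurableSet A) :
    ∫ x in A, condProb μ ρ D x ∂μ = ρ.real (A ×ˢ D) := by
  have hac : fiberMeasure ρ D ≪ μ := by
    rw [← hρ]
    exact Measure.restrict_le_self.absolutelyContinuous.map measurable_fst
  unfold condProb
  rw [Measure.setIntegral_toReal_rnDeriv hac, Measure.real, fiberMeasure_apply ρ D hA, Measure.real]

theorem ae_eq_condProb [IsFiniteMeasure μ] [IsFiniteMeasure ρ] (hρ : ρ.map Prod.fst = μ)
    (D : Set Y) {f : X → ℝ} (hf : Integrable f μ)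
    (h : ∀ A, MeasurableSet A → ∫ x in A, f x ∂μ = ρ.real (A ×ˢ D)) :
    f =ᵐ[μ] condProb μ ρ D :=
  hf.ae_eq_of_forall_setIntegral_eq _ _ (integrable_condProb D) fun A hA _ => by
    rw [h A hA, setIntegral_condProb hρ D hA]

theorem condProb_biUnion [IsFiniteMeasure μ] [IsFiniteMeasure ρ] (hρ : ρ.map Prod.fst = μ)
    {ι : Type*} (F : Finset ι) {B : ι → Set Y} (hB : ∀ i, MeasurableSet (B i))
    (hd : Pairwise (Function.onFun Disjoint B)) :
    (fun x => ∑ i ∈ F, condProb μ ρ (B i) x) =ᵐ[μ] condProb μ ρ (⋃ i ∈ F, B i) := by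
  refine ae_eq_condProb hρ _ (integrable_finsetSum _ fun i _ => integrable_condProb _)
    fun A hA => ?_
  rw [integral_finsetSum _ fun i _ => (integrable_condProb _).integrableOn]
  simp_rw [setIntegral_condProb hρ _ hA]
  rw [Set.prod_iUnion₂]
  exact (measureReal_biUnion_finset (fun i _ j _ hij => Set.disjoint_prod.2 (Or.inr (hd hij)))
    fun i _ => hA.prod (hB i)).symm

theorem condProb_univ [IsFiniteMeasure μ] [IsFiniteMeasure ρ] (hρ : ρ.map Prod.fst = μ) :
    condProb μ ρ Set.univ =ᵐ[μ] fun _ => 1 := by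
  refine (ae_eq_condProb hρ _ (integrable_const _) fun A hA => ?_).symm
  have h : A ×ˢ (Set.univ : Set Y) = Prod.fst ⁻¹' A := by ext; simp
  rw [h, ← map_measureReal_apply measurable_fst hA, hρ]
  simp

theorem real_prod_eq_zero [IsFiniteMeasure ν] (hρ : ρ.map Prod.snd = ν) {D : Set Y}
    (hD : MeasurableSet D) (h0 : ν.real D = 0) (A : Set X) : ρ.real (A ×ˢ D) = 0 := by
  rw [measureReal_eq_zero_iff, ← hρ, Measure.map_apply measurable_snd hD] at h0
  rw [Measure.real, measure_mono_null (fun p hp => hp.2) h0, ENNReal.toReal_zero]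

theorem condProb_eq_zero [IsFiniteMeasure μ] [IsFiniteMeasure ν] [IsFiniteMeasure ρ]
    (hρ : ρ.map Prod.fst = μ) (hρ' : ρ.map Prod.snd = ν) {D : Set Y} (hD : MeasurableSet D)
    (h0 : ν.real D = 0) : condProb μ ρ D =ᵐ[μ] fun _ => 0 := by
  refine (ae_eq_condProb hρ _ (integrable_const _) fun A hA => ?_).symm
  rw [real_prod_eq_zero hρ' hD h0]
  simp

theorem integral_condProb [IsFiniteMeasure μ] [IsFiniteMeasure ρ]
    (hρ : ρ.map Prod.fst = μ) (hρ' : ρ.map Prod.snd = ν) {D : Set Y} (hD : MeasurableSet D) :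
    ∫ x, condProb μ ρ D x ∂μ = ν.real D := by
  rw [← setIntegral_univ, setIntegral_condProb hρ D MeasurableSet.univ, ← hρ',
    map_measureReal_apply measurable_snd hD]
  congr 1
  ext
  simp

/-- Invariance of `ρ` gives the identity of integrals over sets `T ⁻¹' C`. By invertibility every
measurable `A` is of this form modulo a null set, with `C = T' ⁻¹' A`. -/
theorem condProb_preimage [IsFiniteMeasure μ] [IsFiniteMeasure ρ] (hT : MeasurePreserving T μ μ)
    (hTinv : IsInvertible μ T) (hS : Measurable S) (hρ : ρ.map Prod.fst = μ)
    (hinv : ρ.map (Prod.map T S) = ρ) {D : Set Y} (hD : MeasurableSet D) :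
    (fun x => condProb μ ρ D (T x)) =ᵐ[μ] condProb μ ρ (S ⁻¹' D) := by
  obtain ⟨T', hT', hleft, -⟩ := hTinv
  refine ae_eq_condProb hρ _ (hT.integrable_comp_of_integrable (integrable_condProb D))
    fun A hA => ?_
  have hset : (T ⁻¹' (T' ⁻¹' A) : Set X) =ᵐ[μ] A := by
    filter_upwards [hleft] with x hx
    change (T' (T x) ∈ A) = (x ∈ A)
    rw [hx]
  have hmeas : MeasurableSet (T' ⁻¹' A) := hT' hA
  have hfst : ∀ᵐ p ∂ρ, T' (T p.1) = p.1 := by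
    rw [← hρ] at hleft
    exact ae_of_ae_map measurable_fst.aemeasurable hleft
  have hset' : ((T ⁻¹' (T' ⁻¹' A)) ×ˢ (S ⁻¹' D) : Set (X × Y)) =ᵐ[ρ] A ×ˢ (S ⁻¹' D) := by
    filter_upwards [hfst] with p hp
    change (T' (T p.1) ∈ A ∧ S p.2 ∈ D) = (p.1 ∈ A ∧ S p.2 ∈ D)
    rw [hp]
  rw [← setIntegral_congr_set hset]
  calc ∫ x in T ⁻¹' (T' ⁻¹' A), condProb μ ρ D (T x) ∂μ
      = ∫ x in T' ⁻¹' A, condProb μ ρ D x ∂(μ.map T) :=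
        (setIntegral_map hmeas (measurable_condProb μ ρ D).aestronglyMeasurable
          hT.measurable.aemeasurable).symm
    _ = ρ.real ((T' ⁻¹' A) ×ˢ D) := by rw [hT.map_eq, setIntegral_condProb hρ D hmeas]
    _ = (ρ.map (Prod.map T S)).real ((T' ⁻¹' A) ×ˢ D) := by rw [hinv]
    _ = ρ.real ((T ⁻¹' (T' ⁻¹' A)) ×ˢ (S ⁻¹' D)) :=
        map_measureReal_apply (hT.measurable.prodMap hS) (hmeas.prod hD)
    _ = ρ.real (A ×ˢ (S ⁻¹' D)) := measureReal_congr hset'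

theorem condProb_preimage_iterate [IsFiniteMeasure μ] [IsFiniteMeasure ρ]
    (hT : MeasurePreserving T μ μ) (hTinv : IsInvertible μ T) (hS : Measurable S)
    (hρ : ρ.map Prod.fst = μ) (hinv : ρ.map (Prod.map T S) = ρ) {D : Set Y}
    (hD : MeasurableSet D) (n : ℕ) :
    (fun x => condProb μ ρ D (T^[n] x)) =ᵐ[μ] condProb μ ρ (S^[n] ⁻¹' D) := by
  induction n with
  | zero => exact Filter.EventuallyEq.rfl
  | succ n ih =>
    have h1 := hT.quasiMeasurePreserving.ae_eq_comp ih
    have h2 := condProb_preimage hT hTinv hS hρ hinv ((hS.iterate n) hD)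
    exact h1.trans h2

end Joining

/-! ### Binary names and the atoms of the join -/

section Names

open scoped Classical in
/-- The name of `x` with respect to `{A, X \ A}` along `s`. -/
noncomputable def binaryName (T : X → X) (A : Set X) (s : ℕ → ℕ) (N : ℕ) (x : X) : Fin N → Fin 2 :=
  fun i => if T^[s i] x ∈ A then 0 else 1

variable {T : X → X} {A : Set X} {hA : MeasurableSet A} {s : ℕ → ℕ} {N : ℕ}

theorem mem_joinAtom_ofSet {c : Fin N → Fin 2} {x : X} :
    x ∈ joinAtom T (MeasPartition.ofSet A hA) s N c ↔ c = binaryName T A s N x := by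
  simp only [joinAtom, Set.mem_iInter, Set.mem_preimage, funext_iff, binaryName]
  refine forall_congr' fun i => ?_
  have h2 : c i = 0 ∨ c i = 1 := by omega
  rcases h2 with h2 | h2 <;> simp [h2, MeasPartition.ofSet]

theorem measurableSet_joinAtom_ofSet (hT : Measurable T) (c : Fin N → Fin 2) :
    MeasurableSet (joinAtom T (MeasPartition.ofSet A hA) s N c) :=
  MeasurableSet.iInter fun _ => hT.iterate _ (MeasPartition.measurableSet_atom _ _)

theorem disjoint_joinAtom_ofSet :
    Pairwise (Function.onFun Disjoint (joinAtom T (MeasPartition.ofSet A hA) s N)) := by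
  intro c d hcd
  rw [Function.onFun, Set.disjoint_left]
  intro x hc hd
  rw [mem_joinAtom_ofSet] at hc hd
  exact hcd (hc.trans hd.symm)

theorem sum_joinAtom_mul (μ : Measure X) [IsFiniteMeasure μ] (hT : Measurable T)
    (F : (Fin N → Fin 2) → ℝ) :
    ∑ c, μ.real (joinAtom T (MeasPartition.ofSet A hA) s N c) * F c =
      ∫ x, F (binaryName T A s N x) ∂μ := by
  have h : ∀ x, F (binaryName T A s N x) = ∑ c,
      (joinAtom T (MeasPartition.ofSet A hA) s N c).indicator (fun _ => F c) x := by
    intro x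
    classical
    simp_rw [Set.indicator_apply, mem_joinAtom_ofSet]
    simp
  simp_rw [h]
  rw [integral_finsetSum _ fun c _ => (integrable_const _).indicator
    (measurableSet_joinAtom_ofSet hT c)]
  refine Finset.sum_congr rfl fun c _ => ?_
  rw [integral_indicator_const _ (measurableSet_joinAtom_ofSet hT c), smul_eq_mul]

theorem sum_joinAtom_ofSet (μ : Measure X) [IsProbabilityMeasure μ] (hT : Measurable T) :
    ∑ c, μ.real (joinAtom T (MeasPartition.ofSet A hA) s N c) = 1 := by
  simpa using sum_joinAtom_mul (hA := hA) μ hT (s := s) (N := N) fun _ => 1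

theorem integrable_comp_binaryName (μ : Measure X) [IsFiniteMeasure μ] (hT : Measurable T)
    (hA : MeasurableSet A) (F : (Fin N → Fin 2) → ℝ) :
    Integrable (fun x => F (binaryName T A s N x)) μ := by
  have hm : Measurable (binaryName T A s N) := by
    refine measurable_pi_lambda _ fun i => ?_
    exact Measurable.ite (hT.iterate _ hA) measurable_const measurable_const
  refine Integrable.of_bound (C := ∑ c, |F c|)
    ((Measurable.of_discrete.comp hm).aestronglyMeasurable) (.of_forall fun x => ?_)
  exact Finset.single_le_sum (f := fun c => |F c|) (fun c _ => abs_nonneg _) (Finset.mem_univ _)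

end Names

end CondProb

/-! ### Entropy of level sets and disjointness -/

section Disjointness

variable {X Y : Type*} [MeasurableSpace X] [MeasurableSpace Y]
  {μ : Measure X} {T : X → X} {ν : Measure Y} {S : Y → Y} {ρ : Measure (X × Y)}

/-- The names of a level set of a conditional probability of `B` are recovered, up to an error,
by voting from the names of `m` conditionally independent copies of the process of `B`. -/
theorem shannonEntropy_level_le [IsProbabilityMeasure μ] [IsProbabilityMeasure ν]
    (hT : MeasurePreserving T μ μ) (hTinv : IsInvertible μ T) (hS : Measurable S)
    (hρ : IsJoining μ T ν S ρ) {B : Set Y} (hB : MeasurableSet B) (t : ℝ)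
    (hA : MeasurableSet {x | t < condProb μ ρ B x}) (s : ℕ → ℕ) (N : ℕ) {m : ℕ} (hm : 0 < m)
    {η ε : ℝ} (hη : 0 < η) (hε : 0 < ε) (hε1 : ε < 1) :
    shannonEntropy μ (joinAtom T (MeasPartition.ofSet _ hA) s N) ≤
      m * shannonEntropy ν (joinAtom S (MeasPartition.ofSet B hB) s N) +
        N * (-Real.log (1 - ε) + -Real.log ε *
          (μ.real {x | t < condProb μ ρ B x ∧ condProb μ ρ B x < t + 2 * η} +
            1 / (m * η ^ 2))) := by
  have := hρ.isProbabilityMeasure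
  set A : Set X := {x | t < condProb μ ρ B x} with hAdef
  set U : Set X := {x | t < condProb μ ρ B x ∧ condProb μ ρ B x < t + 2 * η} with hU
  have hgm := measurable_condProb μ ρ B
  have hUm : MeasurableSet U :=
    (measurableSet_lt measurable_const hgm).inter (measurableSet_lt hgm measurable_const)
  set b : (Fin N → Fin 2) → Set Y := joinAtom S (MeasPartition.ofSet B hB) s N with hb
  have hbm : ∀ c, MeasurableSet (b c) := measurableSet_joinAtom_ofSet hS
  have hbd : Pairwise (Function.onFun Disjoint b) := disjoint_joinAtom_ofSet
  set P : (Fin N → Fin 2) → ℝ := fun c => ν.real (b c) with hP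
  have hP0 : ∀ c, 0 ≤ P c := fun c => measureReal_nonneg
  have hP1 : ∑ c, P c = 1 := sum_joinAtom_ofSet ν hS
  set q := voteLaw (t + η) ε m P with hq
  set K : ℝ := -Real.log (1 - ε) + -Real.log ε * (1 / (m * η ^ 2)) with hK
  have hlog : 0 ≤ -Real.log ε := by linarith [Real.log_nonpos hε.le hε1.le]
  -- Pointwise majorant of `-log q` at the `A`-name of `x`: cross entropy of the conditional name
  -- law, plus the noise, Chebyshev and strip costs at each time.
  let G : X → ℝ := fun x => m * ∑ c, condProb μ ρ (b c) x * -Real.log (P c) +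
    ∑ i : Fin N, (K + -Real.log ε * U.indicator (fun _ => (1 : ℝ)) (T^[s i] x))
  have hsum : ∀ᵐ x ∂μ, ∑ c, condProb μ ρ (b c) x = 1 := by
    have h1 := condProb_biUnion hρ.map_fst Finset.univ hbm hbd
    have h2 : (⋃ c ∈ Finset.univ, b c) = Set.univ := by
      ext y
      simp [hb, mem_joinAtom_ofSet]
    rw [h2] at h1
    exact h1.trans (condProb_univ hρ.map_fst)
  -- The conditional law of the `B`-name at `x` has `i`-th marginal `g (T^[s i] x)`, the quantity
  -- that decides the `i`-th letter of the `A`-name.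
  have hcoord : ∀ᵐ x ∂μ, ∀ i : Fin N,
      ∑ c, condProb μ ρ (b c) x * (if c i = 0 then 1 else 0) = condProb μ ρ B (T^[s i] x) := by
    rw [ae_all_iff]
    intro i
    have h1 := condProb_biUnion hρ.map_fst (Finset.univ.filter fun c : Fin N → Fin 2 => c i = 0)
      hbm hbd
    have h2 : (⋃ c ∈ Finset.univ.filter fun c : Fin N → Fin 2 => c i = 0, b c) =
        S^[s i] ⁻¹' B := by
      ext y
      simp [hb, mem_joinAtom_ofSet, binaryName]
    rw [h2] at h1
    have h3 := condProb_preimage_iterate hT hTinv hS hρ.map_fst hρ.invariant hB (s i)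
    filter_upwards [h1, h3] with x hx1 hx3
    rw [hx3, ← hx1, Finset.sum_filter]
    exact Finset.sum_congr rfl fun c _ => by split_ifs <;> simp
  have hnull : ∀ᵐ x ∂μ, ∀ c, P c = 0 → condProb μ ρ (b c) x = 0 := by
    rw [ae_all_iff]
    intro c
    by_cases h0 : P c = 0
    · filter_upwards [condProb_eq_zero hρ.map_fst hρ.map_snd (hbm c) h0] with x hx _
      exact hx
    · exact .of_forall fun x h => absurd h h0
  have hle : ∀ᵐ x ∂μ, -Real.log (q (binaryName T A s N x)) ≤ G x := by
    filter_upwards [hsum, hcoord, hnull] with x h1 h2 h3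
    refine (neg_log_voteLaw_le (t + η) hε hε1 m hP0 (fun c => condProb_nonneg μ ρ (b c) x) h1 h3
      _).trans (add_le_add le_rfl (Finset.sum_le_sum fun i _ => ?_))
    have h4 := voteError_le hη hm (fun c => condProb_nonneg μ ρ (b c) x) h1
      (binaryName T A s N x i) i (h2 i) (t := t) (by
        simp only [binaryName, hAdef, Set.mem_ofPred_eq]
        split_ifs with h <;> simp [h])
    have h5 : (if t < condProb μ ρ B (T^[s i] x) ∧ condProb μ ρ B (T^[s i] x) < t + 2 * η
        then 1 else 0) = U.indicator (fun _ => (1 : ℝ)) (T^[s i] x) := by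
      classical
      rw [Set.indicator_apply]
      rfl
    rw [h5] at h4
    have h6 := mul_le_mul_of_nonneg_left h4 hlog
    rw [hK]
    linarith
  have hUi : ∀ i : Fin N, Integrable (fun x => U.indicator (fun _ => (1 : ℝ)) (T^[s i] x)) μ :=
    fun i => (hT.iterate (s i)).integrable_comp_of_integrable
      ((integrable_const (1 : ℝ)).indicator hUm)
  have hci : ∀ c, Integrable (fun x => condProb μ ρ (b c) x * -Real.log (P c)) μ :=
    fun c => (integrable_condProb _).mul_const _
  have hG1 : Integrable (fun x => m * ∑ c, condProb μ ρ (b c) x * -Real.log (P c)) μ :=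
    (integrable_finsetSum _ fun c _ => hci c).const_mul _
  have hKi : ∀ i : Fin N,
      Integrable (fun x => K + -Real.log ε * U.indicator (fun _ => (1 : ℝ)) (T^[s i] x)) μ :=
    fun i => (integrable_const K).add ((hUi i).const_mul _)
  have hG2 : Integrable (fun x => ∑ i : Fin N,
      (K + -Real.log ε * U.indicator (fun _ => (1 : ℝ)) (T^[s i] x))) μ :=
    integrable_finsetSum _ fun i _ => hKi i
  -- The conditional name laws average to `P`, so the cross entropies integrate to the entropy of
  -- `P`; invariance of `μ` gives the strip the same measure at every time.
  have hGint : ∫ x, G x ∂μ = m * shannonEntropy ν b + N * (K + -Real.log ε * μ.real U) := by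
    rw [integral_add hG1 hG2, integral_const_mul, integral_finsetSum _ fun c _ => hci c,
      integral_finsetSum _ fun i _ => hKi i]
    congr 2
    · refine Finset.sum_congr rfl fun c _ => ?_
      rw [integral_mul_const, integral_condProb hρ.map_fst hρ.map_snd (hbm c), Real.negMulLog]
      ring
    · have hi : ∀ i : Fin N, ∫ x, (K + -Real.log ε *
          U.indicator (fun _ => (1 : ℝ)) (T^[s i] x)) ∂μ = K + -Real.log ε * μ.real U := by
        intro i
        have hTi := hT.iterate (s i)
        have h1 : ∫ x, U.indicator (fun _ => (1 : ℝ)) (T^[s i] x) ∂μ = μ.real U := by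
          rw [← integral_map hTi.measurable.aemeasurable
            (measurable_const.indicator hUm).aestronglyMeasurable, hTi.map_eq,
            integral_indicator_const _ hUm]
          simp
        rw [integral_add (integrable_const K) ((hUi i).const_mul _), integral_const_mul, h1]
        simp
      rw [Finset.sum_congr rfl fun i _ => hi i, Finset.sum_const, Finset.card_univ,
        Fintype.card_fin, nsmul_eq_mul]
  calc shannonEntropy μ (joinAtom T (MeasPartition.ofSet A hA) s N)
      ≤ ∑ a, μ.real (joinAtom T (MeasPartition.ofSet A hA) s N a) * -Real.log (q a) :=
        sum_negMulLog_le _ _ (fun _ => measureReal_nonneg)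
          (voteLaw_pos _ hε hε1 m hP0 hP1) (sum_joinAtom_ofSet μ hT.measurable)
          (sum_voteLaw _ _ m P hP1)
    _ = ∫ x, -Real.log (q (binaryName T A s N x)) ∂μ :=
        sum_joinAtom_mul μ hT.measurable fun a => -Real.log (q a)
    _ ≤ ∫ x, G x ∂μ := integral_mono_ae
        (integrable_comp_binaryName μ hT.measurable hA fun a => -Real.log (q a))
        (hG1.add hG2) hle
    _ = _ := by rw [hGint, hK]; ring

/-- The strips decrease to the empty set because `t < g x` is strict. -/
theorem tendsto_measureReal_strip [IsFiniteMeasure μ] {g : X → ℝ} (hg : Measurable g) (t : ℝ) :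
    Filter.Tendsto (fun n : ℕ => μ.real {x | t < g x ∧ g x < t + 2 * (1 / ((n : ℝ) + 1))})
      Filter.atTop (nhds 0) := by
  have hanti : Antitone fun n : ℕ => {x | t < g x ∧ g x < t + 2 * (1 / ((n : ℝ) + 1))} := by
    intro n k hnk x hx
    refine ⟨hx.1, hx.2.trans_le ?_⟩
    have := Nat.one_div_le_one_div (α := ℝ) hnk
    linarith
  have h := tendsto_measure_iInter_atTop (μ := μ)
    (s := fun n : ℕ => {x | t < g x ∧ g x < t + 2 * (1 / ((n : ℝ) + 1))}) (fun n : ℕ =>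
    ((measurableSet_lt measurable_const hg).inter
      (measurableSet_lt hg measurable_const)).nullMeasurableSet) hanti ⟨0, measure_ne_top _ _⟩
  have hempty : ⋂ n : ℕ, {x | t < g x ∧ g x < t + 2 * (1 / ((n : ℝ) + 1))} = ∅ := by
    refine Set.eq_empty_of_forall_notMem fun x hx => ?_
    rw [Set.mem_iInter] at hx
    obtain ⟨n, hn⟩ := exists_nat_one_div_lt (half_pos (sub_pos.2 (hx 0).1))
    linarith [(hx n).2]
  rw [hempty, measure_empty] at h
  exact (ENNReal.tendsto_toReal ENNReal.zero_ne_top).comp h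

/-- If the `A`-names have entropy rate above `δ`, choose `ε`, `η`, `m` independently of `N` so that
the error per letter is at most `δ / 2`. The `B`-names then keep a rate of at least `δ / (2m)`. -/
theorem IsEntropyGenerating.of_level [IsProbabilityMeasure μ] [IsProbabilityMeasure ν]
    (hT : MeasurePreserving T μ μ) (hTinv : IsInvertible μ T) (hS : Measurable S)
    (hρ : IsJoining μ T ν S ρ) {B : Set Y} (hB : MeasurableSet B) (t : ℝ)
    (hA : MeasurableSet {x | t < condProb μ ρ B x}) {s : ℕ → ℕ}
    (hs : IsEntropyGenerating μ T (MeasPartition.ofSet _ hA) s) :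
    IsEntropyGenerating ν S (MeasPartition.ofSet B hB) s := by
  refine ⟨hs.1, ?_⟩
  obtain ⟨δ, hδ, hlim⟩ := EReal.lt_iff_exists_real_btwn.1 hs.2
  have hδ0 : 0 < δ := by exact_mod_cast hδ
  have hev := Filter.eventually_lt_of_lt_liminf hlim
  -- Chosen so that the noise cost is exactly `δ / 4`; the strip and Chebyshev terms will contribute
  -- at most `δ / 8` each.
  set ε : ℝ := 1 - Real.exp (-(δ / 4)) with hεdef
  have hε : 0 < ε := by
    have : Real.exp (-(δ / 4)) < 1 := by simpa using hδ0
    linarith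
  have hε1 : ε < 1 := by linarith [Real.exp_pos (-(δ / 4))]
  have hε2 : -Real.log (1 - ε) = δ / 4 := by
    rw [hεdef, sub_sub_cancel, Real.log_exp, neg_neg]
  set L := -Real.log ε with hL
  have hL0 : 0 < L := by linarith [Real.log_neg hε hε1]
  obtain ⟨n, hn⟩ := ((tendsto_measureReal_strip (μ := μ) (measurable_condProb μ ρ B)
    t).eventually_lt_const (show 0 < δ / 8 / L by positivity)).exists
  set η : ℝ := 1 / ((n : ℝ) + 1) with hηdef
  have hη : 0 < η := by positivity
  obtain ⟨m, hm⟩ := exists_nat_gt (1 / (δ / 8 / L * η ^ 2))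
  have hm0 : (0 : ℝ) < m := lt_of_le_of_lt (by positivity) hm
  have hmn : 0 < m := by exact_mod_cast hm0
  have hm1 : 1 / (m * η ^ 2) < δ / 8 / L := by
    rw [div_lt_iff₀ (by positivity)] at hm ⊢
    nlinarith
  have hpos : (0 : EReal) < ((δ / (2 * m) : ℝ) : EReal) := by
    exact_mod_cast (by positivity : 0 < δ / (2 * m))
  refine hpos.trans_le (Filter.le_liminf_of_le (by isBoundedDefault) ?_)
  filter_upwards [hev, Filter.eventually_gt_atTop 0] with N hN hN0
  have hN' : (0 : ℝ) < N := by exact_mod_cast hN0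
  have hN1 : δ < 1 / (N : ℝ) * shannonEntropy μ (joinAtom T (MeasPartition.ofSet _ hA) s N) := by
    exact_mod_cast hN
  have hbound := shannonEntropy_level_le hT hTinv hS hρ hB t hA s N hmn hη hε hε1
  rw [hε2, ← hL] at hbound
  have herr : L * (μ.real {x | t < condProb μ ρ B x ∧ condProb μ ρ B x < t + 2 * η} +
      1 / (m * η ^ 2)) ≤ δ / 4 := by
    have := mul_le_mul_of_nonneg_left (add_le_add hn.le hm1.le) hL0.le
    have h2 : L * (δ / 8 / L + δ / 8 / L) = δ / 4 := by field_simp; ring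
    linarith
  have herr' := mul_le_mul_of_nonneg_left herr hN'.le
  rw [one_div, inv_mul_eq_div, lt_div_iff₀ hN'] at hN1
  refine EReal.coe_le_coe_iff.2 ?_
  rw [one_div, inv_mul_eq_div, div_le_div_iff₀ (by positivity) hN']
  nlinarith

theorem exists_upperPartDim_le [IsProbabilityMeasure μ] [IsProbabilityMeasure ν]
    (hT : MeasurePreserving T μ μ) (hTinv : IsInvertible μ T) (hS : Measurable S)
    (hρ : IsJoining μ T ν S ρ) (hne : ρ ≠ μ.prod ν) :
    ∃ (A : Set X) (hA : MeasurableSet A) (B : Set Y) (hB : MeasurableSet B),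
      0 < μ A ∧ μ A < 1 ∧ 0 < ν B ∧ ν B < 1 ∧
        upperPartDim μ T (MeasPartition.ofSet A hA) ≤
          upperPartDim ν S (MeasPartition.ofSet B hB) := by
  have := hρ.isProbabilityMeasure
  -- If every conditional probability were constant, `ρ` would agree with the product on all
  -- rectangles.
  obtain ⟨B, hB, hBne⟩ : ∃ B, MeasurableSet B ∧
      ¬ condProb μ ρ B =ᵐ[μ] fun _ => ν.real B := by
    by_contra! h
    refine hne (Measure.prod_eq fun A B hA hB => ?_).symm
    have h1 := setIntegral_condProb hρ.map_fst B hA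
    rw [setIntegral_congr_ae hA ((h B hB).mono fun x hx _ => hx), setIntegral_const,
      smul_eq_mul] at h1
    rw [← ENNReal.toReal_eq_toReal_iff' (measure_ne_top _ _)
      (ENNReal.mul_ne_top (measure_ne_top _ _) (measure_ne_top _ _)), ENNReal.toReal_mul]
    exact h1.symm
  have hgm := measurable_condProb μ ρ B
  have hgi : Integrable (condProb μ ρ B) μ := integrable_condProb B
  have hint := integral_condProb hρ.map_fst hρ.map_snd hB
  set t := ν.real B with ht
  have hA : MeasurableSet {x | t < condProb μ ρ B x} := measurableSet_lt measurable_const hgm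
  refine ⟨_, hA, B, hB, ?_, ?_, ?_, ?_, ?_⟩
  -- A function that stays on one side of its mean `t` almost everywhere equals `t`; this makes both
  -- `A` and its complement non-null.
  · rw [pos_iff_ne_zero]
    intro h0
    have hle : ∀ᵐ x ∂μ, condProb μ ρ B x ≤ t := by
      rw [ae_iff]
      simpa using h0
    refine hBne ?_
    have h1 : ∫ x, (t - condProb μ ρ B x) ∂μ = 0 := by
      rw [integral_sub (integrable_const _) hgi, hint]
      simp
    rw [integral_eq_zero_iff_of_nonneg_ae (hle.mono fun x hx => sub_nonneg.2 hx)
      ((integrable_const _).sub hgi)] at h1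
    filter_upwards [h1] with x hx
    exact (sub_eq_zero.1 hx).symm
  · refine lt_of_le_of_ne prob_le_one fun h1 => ?_
    rw [← prob_compl_eq_zero_iff hA] at h1
    have hlt : ∀ᵐ x ∂μ, t < condProb μ ρ B x := by
      rw [ae_iff]
      exact h1
    refine hBne ?_
    have h1 : ∫ x, (condProb μ ρ B x - t) ∂μ = 0 := by
      rw [integral_sub hgi (integrable_const _), hint]
      simp
    rw [integral_eq_zero_iff_of_nonneg_ae (hlt.mono fun x hx => sub_nonneg.2 hx.le)
      (hgi.sub (integrable_const _))] at h1
    filter_upwards [h1] with x hx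
    exact sub_eq_zero.1 hx
  -- A set `B` of measure `0` or `1` has constant conditional probability, contrary to its choice.
  · rw [pos_iff_ne_zero]
    intro h0
    have h0' : t = 0 := by simp [ht, Measure.real, h0]
    refine hBne ?_
    rw [h0']
    exact condProb_eq_zero hρ.map_fst hρ.map_snd hB h0'
  · refine lt_of_le_of_ne prob_le_one fun h1 => hBne ?_
    have h1' : t = 1 := by simp [ht, Measure.real, h1]
    have hc : ν.real Bᶜ = 0 := by rw [probReal_compl_eq_one_sub hB, ← ht, h1', sub_self]
    rw [h1']
    refine (ae_eq_condProb hρ.map_fst _ (integrable_const _) fun C hC => ?_).symm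
    have h2 := setIntegral_condProb hρ.map_fst Set.univ hC
    rw [setIntegral_congr_ae (g := fun _ => (1 : ℝ)) hC
      ((condProb_univ hρ.map_fst).mono fun x hx _ => hx)] at h2
    rw [h2, ← Set.union_compl_self B, Set.prod_union, measureReal_union
      (Set.disjoint_prod.2 (Or.inr disjoint_compl_right)) (hC.prod hB.compl),
      real_prod_eq_zero hρ.map_snd hB.compl hc, add_zero]
  · exact iSup_mono fun s => iSup_mono' fun hs =>
      ⟨IsEntropyGenerating.of_level hT hTinv hS hρ hB t hA hs, le_rfl⟩

theorem isJoining_prod [IsProbabilityMeasure μ] [IsProbabilityMeasure ν]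
    (hT : MeasurePreserving T μ μ) (hS : MeasurePreserving S ν ν) :
    IsJoining μ T ν S (μ.prod ν) where
  isProbabilityMeasure := inferInstance
  invariant := (hT.prod hS).map_eq
  map_fst := measurePreserving_fst.map_eq
  map_snd := measurePreserving_snd.map_eq

theorem areDisjoint_of_upperPartDim_lt [IsProbabilityMeasure μ] [IsProbabilityMeasure ν]
    (hT : MeasurePreserving T μ μ) (hTinv : IsInvertible μ T) (hS : MeasurePreserving S ν ν)
    (h : ∀ (A : Set X) (hA : MeasurableSet A) (B : Set Y) (hB : MeasurableSet B),
      0 < μ A → μ A < 1 → 0 < ν B → ν B < 1 →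
        upperPartDim ν S (MeasPartition.ofSet B hB) <
          upperPartDim μ T (MeasPartition.ofSet A hA)) :
    AreDisjoint μ T ν S := by
  refine Set.Subset.antisymm (fun ρ hρ => ?_) ?_
  · by_contra hne
    obtain ⟨A, hA, B, hB, h0, h1, h2, h3, hle⟩ :=
      exists_upperPartDim_le hT hTinv hS.measurable hρ hne
    exact (h A hA B hB h0 h1 h2 h3).not_ge hle
  · rintro _ rfl
    exact isJoining_prod hT hS

end Disjointness

end EntropyDimension

/-! ### The corollary -/

theorem mainTheorem10 {X : Type*} {Y : Type*} [MeasurableSpace X] [MeasurableSpace Y]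
    (μ : Measure X) [IsProbabilityMeasure μ] (T : X → X)
    (hT : MeasurePreserving T μ μ) (hTinv : EntropyDimension.IsInvertible μ T)
    (ν : Measure Y) [IsProbabilityMeasure ν] (S : Y → Y)
    (hS : Ergodic S ν) :
    (∀ α β : ℝ≥0∞, β < α → α ≤ 1 →
      EntropyDimension.IsUniformDim μ T α → EntropyDimension.IsUniformDim ν S β →
      EntropyDimension.AreDisjoint μ T ν S) ∧
    (EntropyDimension.StrictlyPositiveDim μ T → EntropyDimension.HasEntropyDim ν S 0 →
      EntropyDimension.AreDisjoint μ T ν S) := by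
  constructor
  · intro α β hβα _ hα hβ
    refine EntropyDimension.areDisjoint_of_upperPartDim_lt hT hTinv hS.toMeasurePreserving
      fun A hA B hB h0 h1 h2 h3 => ?_
    have hA' := hα.subset ⟨A, hA, h0, h1, rfl⟩
    have hB' := hβ.subset ⟨B, hB, h2, h3, rfl⟩
    rw [Set.mem_singleton_iff] at hA' hB'
    rw [hA', hB']
    exact hβα
  · intro hpos hzero
    refine EntropyDimension.areDisjoint_of_upperPartDim_lt hT hTinv hS.toMeasurePreserving
      fun A hA B hB h0 h1 _ _ => ?_
    -- Dimension `0` bounds every partition, in particular the two-set ones, while every nontrivial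
    -- `A` has positive dimension.
    have hB' : EntropyDimension.upperPartDim ν S (.ofSet B hB) ≤ 0 :=
      hzero.1 ▸ le_iSup₂ (f := fun k (P : EntropyDimension.MeasPartition Y k) =>
        EntropyDimension.upperPartDim ν S P) 2 (.ofSet B hB)
    exact hB'.trans_lt (pos_iff_ne_zero.2 fun hA' => hpos ⟨A, hA, h0, h1, hA'.symm⟩)
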